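/- Let $A\in\mathbb C^{n\times n}$, $b\in\mathbb C^n$, let $\lambda_1,\dots,\lambda_m\in\mathbb C$ be points not lying in the spectrum $\sigma(A)$, and let $\varkappa_0,\varkappa_1,\dots,\varkappa_m$ be nonnegative integers. Let $V\in\mathbb C^{n\times\hat n}$, $\hat n\ge1$, satisfy $V^HV=\mathbf 1_{\hat n\times\hat n}$, and suppose that the vectors $$b,\,Ab,\,\dots,\,A^{\varkappa_0-1}b,\qquad (\lambda_k\mathbf 1-A)^{-1}b,\,(\lambda_k\mathbf 1-A)^{-2}b,\,\dots,\,(\lambda_k\mathbf 1-A)^{-\varkappa_k}b\quad(k=1,\dots,m)$$ form a basis of the image of $V$ (as a family: they are linearly independent and span it). Put $\widehat A=V^HAV$ and $\hat b=V^Hb$. Let $\hat\mu_1,\dots,\hat\mu_{\hat m}$ be the distinct eigenvalues of $\widehat A$ and $\hat w_1,\dots,\hat w_{\hat m}$ their algebraic multiplicities, and set $$v(\lambda)=\prod_{k=1}^{m}(\lambda-\lambda_k)^{\varkappa_k},\qquad \Omega(\lambda)=\prod_{k=1}^{\hat m}(\lambda-\hat\mu_k)^{\hat w_k},\qquad \exp_t(\lambda)=e^{\lambda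 t}.$$ Then for every $t\in\mathbb R$ the maximum below is attained and $$\bigl\lVert e^{tA}b-V e^{t\widehat A}\,\hat b\bigr\rVert\le\max_{\substack{s\in[0,1]\\ \mu\in\mathrm{co}\{\hat\mu_1,\dots,\hat\mu_{\hat m}\}}}\biggl\lVert\Omega(A)[v(A)]^{-1}\frac{(v\exp_t)^{(\hat n)}\bigl((1-s)\mu\mathbf 1+sA\bigr)}{\hat n!}\,b\biggr\rVert,$$ where $\lVert\cdot\rVert$ is the Euclidean norm on $\mathbb C^n$, $\mathrm{co}$ denotes the convex hull, $(v\exp_t)^{(\hat n)}$ is the $\hat n$-th derivative, and an entire function $f$ is applied to a square matrix $M$ by $f(M)=\frac1{2\pi i}\int_\Gamma f(\lambda)(\lambda\mathbf 1-M)^{-1}\,d\lambda$ with a contour $\Gamma$ enclosing $\sigma(M)$. -/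

import Mathlib

open scoped Matrix Real

noncomputable section

/-- The radius of a circle centred at the origin that encloses the spectrum of `M`. It is larger
than the sum of the moduli of all the entries of `M`, hence larger than any row sum. -/
def enclosingRadius {n : ℕ} (M : Matrix (Fin n) (Fin n) ℂ) : ℝ :=
  1 + ∑ i, ∑ j, ‖M i j‖

/-- Every eigenvalue of `M` lies strictly inside the circle of radius `enclosingRadius M`. -/
theorem norm_lt_enclosingRadius {n : ℕ} (M : Matrix (Fin n) (Fin n) ℂ) {z : ℂ}
    (hz : z ∈ spectrum ℂ M) : ‖z‖ < enclosingRadius M := by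
  have h1 : Module.End.HasEigenvalue (Matrix.toLin' M) z := by
    rw [Module.End.hasEigenvalue_iff_mem_spectrum, Matrix.spectrum_toLin']
    exact hz
  obtain ⟨k, hk⟩ := eigenvalue_mem_ball h1
  rw [mem_closedBall_iff_norm] at hk
  have h2 : ∑ j, ‖M k j‖ ≤ ∑ i, ∑ j, ‖M i j‖ :=
    Finset.single_le_sum (f := fun i => ∑ j, ‖M i j‖)
      (fun i _ => Finset.sum_nonneg fun j _ => norm_nonneg _) (Finset.mem_univ k)
  have h3 := Finset.add_sum_erase Finset.univ (fun j => ‖M k j‖) (Finset.mem_univ k)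
  have h4 : ‖z‖ ≤ ‖z - M k k‖ + ‖M k k‖ := by
    simpa using norm_add_le (z - M k k) (M k k)
  unfold enclosingRadius
  beta_reduce at h3
  linarith

/-- An entire function `f` applied to a square matrix `M`:
`f(M) = (2πi)⁻¹ ∮ f(z) (z 1 - M)⁻¹ dz`, the integral being taken (entrywise) along a circle that
encloses the spectrum of `M`. As `f` is entire, every contour around the spectrum gives the
same matrix. -/
def entireMatrixFunction {n : ℕ} (f : ℂ → ℂ) (M : Matrix (Fin n) (Fin n) ℂ) :
    Matrix (Fin n) (Fin n) ℂ :=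
  Matrix.of fun i j =>
    (2 * (π : ℂ) * Complex.I)⁻¹ *
      ∮ z in C(0, enclosingRadius M), f z * ((z • (1 : Matrix (Fin n) (Fin n) ℂ) - M)⁻¹ i j)

/-- The family of vectors of the one-sided rational Arnoldi method:
`A ^ j b` for `0 ≤ j < κ₀`, and `(lam k 1 - A)⁻¹ ^ j b` for each `k` and `1 ≤ j ≤ κ k`. -/
def arnoldiVectors {n m : ℕ} (A : Matrix (Fin n) (Fin n) ℂ) (b : Fin n → ℂ)
    (κ₀ : ℕ) (lam : Fin m → ℂ) (κ : Fin m → ℕ) :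
    Fin κ₀ ⊕ (Σ k : Fin m, Fin (κ k)) → (Fin n → ℂ)
  | Sum.inl j => (A ^ (j : ℕ)) *ᵥ b
  | Sum.inr ⟨k, j⟩ =>
      ((lam k • (1 : Matrix (Fin n) (Fin n) ℂ) - A)⁻¹ ^ ((j : ℕ) + 1)) *ᵥ b

/-- The polynomial `∏ k, (z - p k) ^ (w k)`. -/
def nodePolynomial {m : ℕ} (p : Fin m → ℂ) (w : Fin m → ℕ) : Polynomial ℂ :=
  ∏ k, (Polynomial.X - Polynomial.C (p k)) ^ (w k)

/-- The Euclidean norm on `ℂⁿ`. -/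
def euclNorm {n : ℕ} (x : Fin n → ℂ) : ℝ :=
  ‖(WithLp.toLp 2 x : EuclideanSpace ℂ (Fin n))‖

/-- The quantity maximised in the estimate: the Euclidean norm of
`Ω(A) v(A)⁻¹ ((v exp_t)^(N) ((1 - s) μ 1 + s A) / N!) b`, where `exp_t(z) = e ^ (t z)`. -/
def arnoldiBoundTerm {n : ℕ} (A : Matrix (Fin n) (Fin n) ℂ) (b : Fin n → ℂ)
    (Om v : Polynomial ℂ) (N : ℕ) (t s : ℝ) (μ : ℂ) : ℝ :=
  euclNorm ((Polynomial.aeval A Om * (Polynomial.aeval A v)⁻¹ *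
    (((N.factorial : ℂ)⁻¹) •
      entireMatrixFunction
        (iteratedDeriv N fun z : ℂ => v.eval z * Complex.exp ((t : ℂ) * z))
        (((1 - (s : ℂ)) * μ) • (1 : Matrix (Fin n) (Fin n) ℂ) + (s : ℂ) • A))) *ᵥ b)

end

/-!
Write `b = v(A) w`. The span of the rational Krylov vectors is then the polynomial Krylov space of
`A` and `w`, of dimension `nhat`, and `e ^ (tA) b = g(A) w` with `g = v exp_t`. Newton-interpolate
`g` at the eigenvalues of `Ahat`: the projection reproduces the interpolating polynomial, whose
degree is less than `nhat`, and Cayley–Hamilton kills the remainder in `Ahat`. So the error is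
`Ω(A) g[μ₁, …, μ_nhat, A] w`, where `μ₁, …, μ_nhat` are the eigenvalues of `Ahat` repeated according
to multiplicity, and the Hermite–Genocchi formula averages the divided difference, with total mass
`1 / nhat!`, over values of the `nhat`-th derivative of `g` at `(1 - s) μ + s A` with `μ` in the
convex hull of the eigenvalues.
-/

section CircleCalculus

open Metric Real

variable {𝔸 : Type*} [NormedRing 𝔸] [NormedAlgebra ℂ 𝔸] {a b : 𝔸} {R : ℝ} {f g : ℂ → ℂ}

/-- The Riesz–Dunford integral `(2πi)⁻¹ ∮ f(z) (z - a)⁻¹ dz` over the circle `|z| = R`. Parametrised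
by the angle it is the average of `f(z) z (z - a)⁻¹` over the circle. -/
noncomputable def circleCalculus (a : 𝔸) (R : ℝ) (f : ℂ → ℂ) : 𝔸 :=
  circleAverage (fun z => f z • z • resolvent a z) 0 R

theorem mem_resolventSet_of_le_norm (hR : spectrum ℂ a ⊆ ball 0 R) {z : ℂ} (hz : R ≤ ‖z‖) :
    z ∈ resolventSet ℂ a := by
  by_contra h
  exact (mem_ball_zero_iff.1 (hR h)).not_ge hz

theorem isUnit_one_sub_smul_of_spectrum_subset_ball (hR : spectrum ℂ a ⊆ ball 0 R)
    {z : ℂ} (hz : ‖z‖ ≤ R⁻¹) : IsUnit (1 - z • a) := by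
  rcases eq_or_ne z 0 with rfl | hz₀
  · simp
  have hinv : R ≤ ‖z⁻¹‖ := by
    rw [norm_inv]
    exact le_inv_of_le_inv₀ (norm_pos_iff.2 hz₀) hz
  have h := (mem_resolventSet_of_le_norm hR hinv).smul (Units.mk0 z hz₀)
  rwa [Units.smul_mk0, smul_sub, Algebra.algebraMap_eq_smul_one, smul_inv_smul₀ hz₀] at h

theorem smul_resolvent_eq_one_add (hR : spectrum ℂ a ⊆ ball 0 R) {z : ℂ} (hz : R ≤ ‖z‖) :
    z • resolvent a z = 1 + a * resolvent a z := by
  have h := Ring.mul_inverse_cancel _ (mem_resolventSet_of_le_norm hR hz)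
  rw [sub_mul, ← Algebra.smul_def, sub_eq_iff_eq_add] at h
  exact h

theorem smul_resolvent_eq_inverse {z : ℂ} (hz : z ≠ 0) :
    z • resolvent a z = Ring.inverse (1 - z⁻¹ • a) := by
  simpa only [Units.smul_mk0, resolvent, map_one, Units.smul_def, Units.val_inv_eq_inv_val,
    Units.val_mk0] using spectrum.units_smul_resolvent_self (r := Units.mk0 z hz) (a := a)

theorem circleCalculus_const_mul (c : ℂ) (f : ℂ → ℂ) :
    circleCalculus a R (fun z => c * f z) = c • circleCalculus a R f := by
  simp only [circleCalculus, mul_smul]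
  exact circleAverage_fun_smul

variable [CompleteSpace 𝔸]

theorem continuousOn_resolvent (hR : spectrum ℂ a ⊆ ball 0 R) :
    ContinuousOn (resolvent a) (sphere (0 : ℂ) R) := fun _ hz =>
  have hmem := mem_resolventSet_of_le_norm hR (mem_sphere_zero_iff_norm.1 hz).ge
  (spectrum.hasDerivAt_resolvent_const_left hmem).continuousAt.continuousWithinAt

theorem continuous_smul_resolvent_circleMap (hR₀ : 0 < R) (hR : spectrum ℂ a ⊆ ball 0 R) :
    Continuous fun θ : ℝ => circleMap 0 R θ • resolvent a (circleMap 0 R θ) :=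
  (continuous_circleMap 0 R).smul <|
    (continuousOn_resolvent hR).comp_continuous (continuous_circleMap 0 R)
      (circleMap_mem_sphere 0 hR₀.le)

theorem circleIntegrable_smul_resolvent (hR₀ : 0 < R) (hR : spectrum ℂ a ⊆ ball 0 R)
    (hf : Continuous f) : CircleIntegrable (fun z => f z • z • resolvent a z) 0 R :=
  ((hf.comp (continuous_circleMap 0 R)).smul
    (continuous_smul_resolvent_circleMap hR₀ hR)).intervalIntegrable _ _

theorem map_circleCalculus_eq_circleIntegral {E : Type*} [NormedAddCommGroup E] [NormedSpace ℂ E]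
    [CompleteSpace E] (hR₀ : 0 < R) (hR : spectrum ℂ a ⊆ ball 0 R) (hf : Continuous f)
    (φ : 𝔸 →L[ℂ] E) :
    φ (circleCalculus a R f) =
      (2 * (π : ℂ) * Complex.I)⁻¹ • ∮ z in C(0, R), f z • φ (resolvent a z) := by
  have h := (φ.restrictScalars ℝ).circleAverage_comp_comm
    (circleIntegrable_smul_resolvent hR₀ hR hf)
  rw [circleAverage_eq_circleIntegral hR₀.ne'] at h
  refine h.symm.trans (congrArg _ (circleIntegral.integral_congr hR₀.le fun z hz => ?_))
  have hz₀ : z ≠ 0 := ne_of_mem_sphere hz hR₀.ne'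
  simp only [sub_zero, Function.comp_apply, ContinuousLinearMap.coe_restrictScalars', map_smul]
  rw [smul_comm (f z), inv_smul_smul₀ hz₀]

theorem circleCalculus_add (hR₀ : 0 < R) (hR : spectrum ℂ a ⊆ ball 0 R)
    (hf : Continuous f) (hg : Continuous g) :
    circleCalculus a R (fun z => f z + g z) = circleCalculus a R f + circleCalculus a R g := by
  simp only [circleCalculus, add_smul]
  exact circleAverage_fun_add (circleIntegrable_smul_resolvent hR₀ hR hf)
    (circleIntegrable_smul_resolvent hR₀ hR hg)

theorem circleCalculus_one (hR₀ : 0 < R) (hR : spectrum ℂ a ⊆ ball 0 R) :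
    circleCalculus a R (fun _ => 1) = 1 := by
  -- Inverting the circle turns `z (z - a)⁻¹` into `(1 - w a)⁻¹`, which is holomorphic inside.
  have hdiff : ∀ w ∈ closedBall (0 : ℂ) |R⁻¹|,
      DifferentiableAt ℂ (fun w : ℂ => Ring.inverse (1 - w • a)) w := fun w hw => by
    rw [abs_of_pos (inv_pos.2 hR₀), mem_closedBall_zero_iff] at hw
    obtain ⟨u, hu⟩ := isUnit_one_sub_smul_of_spectrum_subset_ball hR hw
    have hinv := (hasFDerivAt_ringInverse (𝕜 := ℂ) u).differentiableAt
    rw [hu] at hinv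
    exact hinv.comp w (f := fun w : ℂ => 1 - w • a) (by fun_prop)
  have hmean : circleAverage (fun w : ℂ => Ring.inverse (1 - w • a)) 0 R⁻¹ = 1 := by
    rw [circleAverage_of_differentiable_on_off_countable Set.countable_empty
      (fun w hw => (hdiff w hw).continuousAt.continuousWithinAt)
      (fun w hw => hdiff w (ball_subset_closedBall hw.1))]
    simp
  rw [← hmean, circleCalculus, circleAverage_eq_circleAverage_zero_one,
    ← circleAverage_zero_one_congr_inv, circleAverage_eq_circleAverage_zero_one (R := R⁻¹)]
  refine circleAverage_congr_sphere fun z hz => ?_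
  have hRz : (R : ℂ) * z⁻¹ ≠ 0 :=
    mul_ne_zero (mod_cast hR₀.ne') (inv_ne_zero (ne_of_mem_sphere hz (by simp)))
  simp only [add_zero, one_smul]
  rw [smul_resolvent_eq_inverse hRz, mul_inv, inv_inv, Complex.ofReal_inv]

theorem circleCalculus_id_mul (hR₀ : 0 < R) (hR : spectrum ℂ a ⊆ ball 0 R)
    (hf : Differentiable ℂ f) :
    circleCalculus a R (fun z => z * f z) = a * circleCalculus a R f := by
  have hmean : circleAverage (fun z => (z * f z) • (1 : 𝔸)) 0 R = 0 := by
    rw [(Differentiable.diffContOnCl (by fun_prop)).circleAverage]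
    simp
  have hconst : CircleIntegrable (fun z => (z * f z) • (1 : 𝔸)) 0 R :=
    (Continuous.continuousOn (by have := hf.continuous; fun_prop)).circleIntegrable hR₀.le
  have hint := circleIntegrable_smul_resolvent hR₀ hR hf.continuous
  calc circleCalculus a R (fun z => z * f z)
      = circleAverage (fun z => (z * f z) • (1 : 𝔸) + a * (f z • z • resolvent a z)) 0 R := by
        refine circleAverage_congr_sphere fun z hz => ?_
        rw [abs_of_pos hR₀, mem_sphere_zero_iff_norm] at hz
        simp only [mul_smul_comm, ← smul_assoc, smul_eq_mul, mul_comm (f z) z]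
        rw [mul_smul, smul_resolvent_eq_one_add hR hz.ge, smul_add]
    _ = circleAverage (fun z => (z * f z) • (1 : 𝔸)) 0 R +
          circleAverage (ContinuousLinearMap.mul ℝ 𝔸 a ∘ fun z => f z • z • resolvent a z) 0 R :=
        circleAverage_fun_add hconst
          ⟨(ContinuousLinearMap.mul ℝ 𝔸 a).integrable_comp hint.1,
            (ContinuousLinearMap.mul ℝ 𝔸 a).integrable_comp hint.2⟩
    _ = a * circleCalculus a R f := by
        rw [hmean, zero_add, ContinuousLinearMap.circleAverage_comp_comm _ hint]
        rfl

theorem circleCalculus_eval_mul (hR₀ : 0 < R) (hR : spectrum ℂ a ⊆ ball 0 R)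
    (hf : Differentiable ℂ f) (p : Polynomial ℂ) :
    circleCalculus a R (fun z => p.eval z * f z) = Polynomial.aeval a p * circleCalculus a R f := by
  induction p using Polynomial.induction_on with
  | C c => simp only [Polynomial.eval_C, circleCalculus_const_mul, Polynomial.aeval_C,
      ← Algebra.smul_def]
  | add p q hp hq =>
    simp only [Polynomial.eval_add, add_mul, map_add]
    rw [← hp, ← hq]
    exact circleCalculus_add hR₀ hR (p.continuous.mul hf.continuous)
      (q.continuous.mul hf.continuous)
  | monomial n c ih =>
    rw [pow_succ', ← mul_assoc, ← Polynomial.X_mul_C, mul_assoc, map_mul, Polynomial.aeval_X,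
      mul_assoc, ← ih, ← circleCalculus_id_mul hR₀ hR (by fun_prop)]
    simp only [Polynomial.eval_mul, Polynomial.eval_X, mul_assoc]

theorem circleCalculus_eval (hR₀ : 0 < R) (hR : spectrum ℂ a ⊆ ball 0 R) (p : Polynomial ℂ) :
    circleCalculus a R p.eval = Polynomial.aeval a p := by
  have h := circleCalculus_eval_mul hR₀ hR (differentiable_const 1) p
  simpa only [mul_one, circleCalculus_one hR₀ hR] using h

theorem summable_norm_taylorCoeff_mul_pow (hf : Differentiable ℂ f) (c : ℂ) {ρ : ℝ} (hρ : 0 ≤ ρ) :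
    Summable fun k : ℕ => ‖(k.factorial : ℂ)⁻¹ * iteratedDeriv k f c‖ * ρ ^ k := by
  refine (Complex.hasSum_taylorSeries_of_entire hf c (c + ρ)).summable.norm.congr fun k => ?_
  simp only [add_sub_cancel_left, norm_smul, norm_pow, Complex.norm_real, norm_mul,
    norm_of_nonneg hρ]
  ring

theorem circleCalculus_sub_pow (hR₀ : 0 < R) (hR : spectrum ℂ a ⊆ ball 0 R) (c : ℂ) (k : ℕ) :
    circleCalculus a R (fun z => (z - c) ^ k) = (a - c • 1) ^ k := by
  have h := circleCalculus_eval hR₀ hR ((Polynomial.X - Polynomial.C c) ^ k)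
  simpa only [Polynomial.eval_pow, Polynomial.eval_sub, Polynomial.eval_X, Polynomial.eval_C,
    map_pow, map_sub, Polynomial.aeval_X, Polynomial.aeval_C, Algebra.algebraMap_eq_smul_one]
    using h

theorem hasSum_circleCalculus (hR₀ : 0 < R) (hR : spectrum ℂ a ⊆ ball 0 R)
    (hf : Differentiable ℂ f) (c : ℂ) :
    HasSum (fun k : ℕ => ((k.factorial : ℂ)⁻¹ * iteratedDeriv k f c) • (a - c • 1) ^ k)
      (circleCalculus a R f) := by
  simp only [← circleCalculus_sub_pow hR₀ hR, ← circleCalculus_const_mul]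
  refine HasSum.const_smul _ ?_
  have hK := continuous_smul_resolvent_circleMap hR₀ hR
  have hsum := summable_norm_taylorCoeff_mul_pow hf c (by positivity : 0 ≤ R + ‖c‖)
  refine intervalIntegral.hasSum_integral_of_dominated_convergence
    (fun k θ => ‖(k.factorial : ℂ)⁻¹ * iteratedDeriv k f c‖ * (R + ‖c‖) ^ k *
      ‖circleMap 0 R θ • resolvent a (circleMap 0 R θ)‖) (fun k => ?_) (fun k => ?_) ?_ ?_ ?_
  · exact Continuous.aestronglyMeasurable (by fun_prop)
  · refine .of_forall fun θ _ => ?_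
    rw [norm_smul _ (_ • _), norm_mul, norm_pow]
    gcongr
    exact (norm_sub_le _ _).trans_eq (by rw [norm_circleMap_zero, abs_of_pos hR₀])
  · exact .of_forall fun θ _ => hsum.mul_right _
  · simp only [tsum_mul_right]
    exact Continuous.intervalIntegrable (by fun_prop) _ _
  · refine .of_forall fun θ _ => HasSum.smul_const ?_ _
    simpa only [smul_eq_mul, mul_assoc, mul_comm (_ ^ _)] using
      Complex.hasSum_taylorSeries_of_entire hf c (circleMap 0 R θ)

theorem commute_circleCalculus (hR₀ : 0 < R) (hR : spectrum ℂ a ⊆ ball 0 R)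
    (hf : Differentiable ℂ f) (h : Commute b a) : Commute b (circleCalculus a R f) := by
  rw [← (hasSum_circleCalculus hR₀ hR hf 0).tsum_eq]
  exact Commute.tsum_right _ fun k => (((h.sub_right (by simp)).pow_right k).smul_right _)

theorem circleCalculus_exp (hR₀ : 0 < R) (hR : spectrum ℂ a ⊆ ball 0 R) (t : ℂ) :
    circleCalculus a R (fun z => Complex.exp (t * z)) = NormedSpace.exp (t • a) := by
  refine (hasSum_circleCalculus hR₀ hR (by fun_prop) 0).unique ?_
  convert NormedSpace.exp_series_hasSum_exp' (𝕂 := ℂ) (t • a) using 2 with k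
  simp [iteratedDeriv_cexp_const_mul, smul_pow, smul_smul]

theorem circleCalculus_comp_affine {S : ℝ} (hR₀ : 0 < R) (hR : spectrum ℂ a ⊆ ball 0 R)
    (hf : Differentiable ℂ f) (c s : ℂ) (hS₀ : 0 < S)
    (hS : spectrum ℂ (c • 1 + s • a) ⊆ ball 0 S) :
    circleCalculus (c • 1 + s • a) S f = circleCalculus a R (fun z => f (c + s * z)) := by
  refine (hasSum_circleCalculus hS₀ hS hf c).unique ?_
  convert hasSum_circleCalculus hR₀ hR (f := fun z => f (c + s * z)) (by fun_prop) 0 using 2 with k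
  have hderiv : iteratedDeriv k (fun z => f (c + s * z)) 0 = s ^ k * iteratedDeriv k f c := by
    have hcontDiff : ContDiff ℂ k fun z => f (c + z) :=
      hf.contDiff.comp (contDiff_const.add contDiff_id)
    simpa [iteratedDeriv_comp_const_add] using
      congrFun (iteratedDeriv_comp_const_mul hcontDiff s) 0
  rw [hderiv, add_sub_cancel_left, zero_smul, sub_zero, smul_pow, smul_smul]
  congr 1
  ring

theorem circleCalculus_intervalIntegral (hR₀ : 0 < R) (hR : spectrum ℂ a ⊆ ball 0 R)
    {F : ℝ → ℂ → ℂ} (hF : Continuous F.uncurry) (α β : ℝ) :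
    circleCalculus a R (fun z => ∫ r in α..β, F r z) = ∫ r in α..β, circleCalculus a R (F r) := by
  have hK := continuous_smul_resolvent_circleMap hR₀ hR
  have hint : Continuous
      (fun θ r => F r (circleMap 0 R θ) • circleMap 0 R θ •
        resolvent a (circleMap 0 R θ)).uncurry :=
    (hF.comp (continuous_snd.prodMk ((continuous_circleMap 0 R).comp continuous_fst))).smul
      (hK.comp continuous_fst)
  simp only [circleCalculus, circleAverage_def, ← intervalIntegral.integral_smul_const]
  rw [intervalIntegral.integral_smul, MeasureTheory.intervalIntegral_intervalIntegral_swap]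
  exact (hint.continuousOn.integrableOn_compact (isCompact_uIcc.prod isCompact_uIcc)).mono_set
    (Set.prod_mono Set.uIoc_subset_uIcc Set.uIoc_subset_uIcc)

theorem continuous_circleCalculus {X : Type*} [TopologicalSpace X] (hR₀ : 0 < R)
    (hR : spectrum ℂ a ⊆ ball 0 R) {F : X → ℂ → ℂ} (hF : Continuous F.uncurry) :
    Continuous fun x => circleCalculus a R (F x) := by
  have hK := continuous_smul_resolvent_circleMap hR₀ hR
  refine Continuous.const_smul
    (intervalIntegral.continuous_parametric_intervalIntegral_of_continuous' ?_ _ _) _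
  exact (hF.comp (continuous_fst.prodMk ((continuous_circleMap 0 R).comp continuous_snd))).smul
    (hK.comp continuous_snd)

end CircleCalculus

section DividedDifference

open Polynomial

section Newton

variable {𝕜 E : Type*} [NontriviallyNormedField 𝕜] [NormedAddCommGroup E] [NormedSpace 𝕜 E]

/-- The divided difference `z ↦ f[c₁, …, cₙ, z]`. Iterating `dslope` allows repeated nodes, at
which derivatives of `f` replace the difference quotients. -/
noncomputable def dividedDifference (f : 𝕜 → E) : List 𝕜 → 𝕜 → E
  | [] => f
  | c :: l => dividedDifference (dslope f c) l

/-- The Newton form of the polynomial that interpolates `f` at a list of nodes, a repeated node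
being an interpolation condition on derivatives. -/
noncomputable def newtonPolynomial (f : 𝕜 → 𝕜) : List 𝕜 → 𝕜[X]
  | [] => 0
  | c :: l => C (f c) + (X - C c) * newtonPolynomial (dslope f c) l

theorem degree_newtonPolynomial_lt (f : 𝕜 → 𝕜) (l : List 𝕜) :
    (newtonPolynomial f l).degree < l.length := by
  induction l generalizing f with
  | nil => simp [newtonPolynomial, bot_lt_iff_ne_bot]
  | cons c l ih =>
    refine (degree_add_le _ _).trans_lt (max_lt ?_ ?_)
    · exact degree_C_le.trans_lt (mod_cast l.length.succ_pos)
    · rw [degree_mul, degree_X_sub_C, add_comm, List.length_cons, Nat.cast_succ]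
      exact WithBot.add_lt_add_right WithBot.one_ne_bot (ih _)

theorem eval_newtonPolynomial_add (f : 𝕜 → 𝕜) (l : List 𝕜) (z : 𝕜) :
    (newtonPolynomial f l).eval z +
      (l.map fun c => X - C c).prod.eval z * dividedDifference f l z = f z := by
  induction l generalizing f with
  | nil => simp [newtonPolynomial, dividedDifference]
  | cons c l ih =>
    have h := sub_smul_dslope f c z
    rw [← ih (dslope f c), smul_eq_mul] at h
    simp only [newtonPolynomial, dividedDifference, List.map_cons, List.prod_cons, eval_add,
      eval_mul, eval_sub, eval_X, eval_C]
    linear_combination h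

end Newton

variable {f : ℂ → ℂ}

theorem differentiable_dslope (hf : Differentiable ℂ f) (c : ℂ) :
    Differentiable ℂ (dslope f c) := by
  rw [← differentiableOn_univ] at hf ⊢
  exact (Complex.differentiableOn_dslope Filter.univ_mem).2 hf

theorem differentiable_dividedDifference (hf : Differentiable ℂ f) (l : List ℂ) :
    Differentiable ℂ (dividedDifference f l) := by
  induction l generalizing f with
  | nil => exact hf
  | cons c _ ih => exact ih (differentiable_dslope hf c)

theorem differentiable_iteratedDeriv_of_entire (hf : Differentiable ℂ f) (j : ℕ) :
    Differentiable ℂ (iteratedDeriv j f) :=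
  (hf.contDiff (n := j + 1)).differentiable_iteratedDeriv' j

theorem hasDerivAt_iteratedDeriv_of_entire (hf : Differentiable ℂ f) (j : ℕ) (z : ℂ) :
    HasDerivAt (iteratedDeriv j f) (iteratedDeriv (j + 1) f z) z := by
  rw [iteratedDeriv_succ]
  exact (differentiable_iteratedDeriv_of_entire hf j z).hasDerivAt

theorem sub_mul_iteratedDeriv_dslope_add (hf : Differentiable ℂ f) (c : ℂ) (j : ℕ) (z : ℂ) :
    (z - c) * iteratedDeriv (j + 1) (dslope f c) z + (j + 1) * iteratedDeriv j (dslope f c) z =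
      iteratedDeriv (j + 1) f z := by
  have hg := differentiable_dslope hf c
  have hprod (j : ℕ) (z : ℂ) : HasDerivAt (fun z => (z - c) * iteratedDeriv j (dslope f c) z)
      (iteratedDeriv j (dslope f c) z + (z - c) * iteratedDeriv (j + 1) (dslope f c) z) z := by
    simpa using! ((hasDerivAt_id z).sub_const c).mul (hasDerivAt_iteratedDeriv_of_entire hg j z)
  induction j generalizing z with
  | zero =>
    have hfun : (fun z => (z - c) * iteratedDeriv 0 (dslope f c) z) = fun z => f z - f c :=
      funext fun z => by simpa using sub_smul_dslope f c z
    have h := hprod 0 z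
    rw [hfun] at h
    have h' := h.unique ((hf z).hasDerivAt.sub_const (f c))
    simp only [zero_add, CharP.cast_eq_zero, one_mul, iteratedDeriv_one (f := f)] at h' ⊢
    rw [← h', add_comm]
  | succ j ih =>
    have h := ((hprod (j + 1) z).add
      ((hasDerivAt_iteratedDeriv_of_entire hg j z).const_mul ((j : ℂ) + 1))).unique
      ((hasDerivAt_iteratedDeriv_of_entire hf (j + 1) z).congr_of_eventuallyEq
        (.of_forall ih))
    push_cast
    linear_combination h

/-- One step of the Hermite–Genocchi formula: `g = dslope f c` satisfies
`(r ^ (j + 1) g⁽ʲ⁾(c + r (z - c)))' = r ^ j f⁽ʲ⁺¹⁾(c + r (z - c))`. -/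
theorem iteratedDeriv_dslope_eq_integral (hf : Differentiable ℂ f) (c : ℂ) (j : ℕ) (z : ℂ) :
    iteratedDeriv j (dslope f c) z =
      ∫ r in (0 : ℝ)..1, (r : ℂ) ^ j * iteratedDeriv (j + 1) f (c + r * (z - c)) := by
  have hg := differentiable_dslope hf c
  have hderiv (r : ℝ) : HasDerivAt
      (fun r : ℝ => (r : ℂ) ^ (j + 1) * iteratedDeriv j (dslope f c) (c + r * (z - c)))
      ((r : ℂ) ^ j * iteratedDeriv (j + 1) f (c + r * (z - c))) r := by
    have hpath : HasDerivAt (fun r : ℂ => c + r * (z - c)) (z - c) r := by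
      simpa using ((hasDerivAt_id (r : ℂ)).mul_const (z - c)).const_add c
    convert (((hasDerivAt_pow (j + 1) (r : ℂ)).mul
      ((hasDerivAt_iteratedDeriv_of_entire hg j _).comp (r : ℂ) hpath)).comp_ofReal) using 1
    · rfl
    · rw [← sub_mul_iteratedDeriv_dslope_add hf c j]
      simp only [add_sub_cancel_left, Nat.cast_add, Nat.cast_one, Nat.add_sub_cancel,
        Function.comp_apply]
      ring
  have hcont := (differentiable_iteratedDeriv_of_entire hf (j + 1)).continuous
  rw [intervalIntegral.integral_eq_sub_of_hasDerivAt (fun r _ => hderiv r)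
    (Continuous.intervalIntegrable (by fun_prop) _ _)]
  simp

end DividedDifference

section HermiteGenocchiBound

open Metric Set

variable {𝔸 : Type*} [NormedRing 𝔸] [NormedAlgebra ℂ 𝔸] [CompleteSpace 𝔸] {a : 𝔸} {R : ℝ}
  {f : ℂ → ℂ} {E : Type*} [NormedAddCommGroup E] [NormedSpace ℂ E] [CompleteSpace E]
  {K : Set ℂ} {C : ℝ}

theorem circleCalculus_iteratedDeriv_dslope (hR₀ : 0 < R) (hR : spectrum ℂ a ⊆ ball 0 R)
    (hf : Differentiable ℂ f) (c : ℂ) (j : ℕ) (p s : ℂ) :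
    circleCalculus a R (fun z => iteratedDeriv j (dslope f c) (p + s * z)) =
      ∫ r in (0 : ℝ)..1, (r : ℂ) ^ j •
        circleCalculus a R (fun z => iteratedDeriv (j + 1) f (c + r * (p + s * z - c))) := by
  have hcont := (differentiable_iteratedDeriv_of_entire hf (j + 1)).continuous
  simp only [iteratedDeriv_dslope_eq_integral hf, ← circleCalculus_const_mul]
  exact circleCalculus_intervalIntegral hR₀ hR (by fun_prop) _ _

theorem exists_mem_convex_combination_eq (hK : Convex ℝ K) {c μ : ℂ} (hc : c ∈ K) (hμ : μ ∈ K)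
    {r s : ℝ} (hr : r ∈ Icc (0 : ℝ) 1) (hs : s ∈ Icc (0 : ℝ) 1) :
    ∃ ν ∈ K, (1 - r) * c + r * (1 - s) * μ = (1 - (r * s : ℝ)) * ν := by
  have h := hK.add_smul (sub_nonneg.2 hr.2) (mul_nonneg hr.1 (sub_nonneg.2 hs.2))
  have hmem := Set.add_mem_add (Set.smul_mem_smul_set (a := 1 - r) hc)
    (Set.smul_mem_smul_set (a := r * (1 - s)) hμ)
  rw [← h] at hmem
  obtain ⟨ν, hν, hν_eq⟩ := hmem
  refine ⟨ν, hν, ?_⟩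
  simp only [Complex.real_smul] at hν_eq
  push_cast at hν_eq ⊢
  linear_combination -hν_eq

theorem norm_circleCalculus_iteratedDeriv_dslope_le (hR₀ : 0 < R) (hR : spectrum ℂ a ⊆ ball 0 R)
    (hf : Differentiable ℂ f) (L : 𝔸 →L[ℂ] E) (hK : Convex ℝ K) {c : ℂ} (hc : c ∈ K) (j : ℕ)
    (hC : ∀ s ∈ Icc (0 : ℝ) 1, ∀ μ ∈ K,
      ‖L (circleCalculus a R fun z => iteratedDeriv (j + 1) f ((1 - s) * μ + s * z))‖ ≤ C)
    {s : ℝ} (hs : s ∈ Icc (0 : ℝ) 1) {μ : ℂ} (hμ : μ ∈ K) :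
    ‖L (circleCalculus a R fun z => iteratedDeriv j (dslope f c) ((1 - s) * μ + s * z))‖ ≤
      C / (j + 1) := by
  set G : ℝ → 𝔸 := fun r => circleCalculus a R fun z =>
    iteratedDeriv (j + 1) f (c + r * ((1 - s) * μ + s * z - c)) with hG
  have hG_cont : Continuous G :=
    continuous_circleCalculus hR₀ hR <|
      (differentiable_iteratedDeriv_of_entire hf (j + 1)).continuous.comp (by fun_prop)
  have hG_le : ∀ r ∈ Icc (0 : ℝ) 1, ‖L (G r)‖ ≤ C := fun r hr => by
    obtain ⟨ν, hν, hν_eq⟩ := exists_mem_convex_combination_eq hK hc hμ hr hs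
    have harg (z : ℂ) : c + r * ((1 - s) * μ + s * z - c) =
        (1 - (r * s : ℝ)) * ν + (r * s : ℝ) * z := by
      rw [← hν_eq]
      push_cast
      ring
    simp only [hG, harg]
    exact hC _ ⟨mul_nonneg hr.1 hs.1, mul_le_one₀ hr.2 hs.1 hs.2⟩ ν hν
  calc ‖L (circleCalculus a R fun z => iteratedDeriv j (dslope f c) ((1 - s) * μ + s * z))‖
      = ‖L (∫ r in (0 : ℝ)..1, (r : ℂ) ^ j • G r)‖ := by
        rw [circleCalculus_iteratedDeriv_dslope hR₀ hR hf]
    _ = ‖∫ r in (0 : ℝ)..1, (r : ℂ) ^ j • L (G r)‖ := by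
        rw [← L.intervalIntegral_comp_comm (Continuous.intervalIntegrable (by fun_prop) _ _)]
        simp only [map_smul]
    _ ≤ ∫ r in (0 : ℝ)..1, r ^ j * C := by
        refine intervalIntegral.norm_integral_le_of_norm_le zero_le_one (.of_forall fun r hr => ?_)
          (Continuous.intervalIntegrable (by fun_prop) _ _)
        rw [norm_smul, norm_pow, Complex.norm_of_nonneg hr.1.le]
        exact mul_le_mul_of_nonneg_left (hG_le r (Ioc_subset_Icc_self hr))
          (pow_nonneg hr.1.le j)
    _ = C / (j + 1) := by
        rw [intervalIntegral.integral_mul_const, integral_pow]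
        simp [div_eq_inv_mul]

theorem norm_circleCalculus_dividedDifference_le (hR₀ : 0 < R) (hR : spectrum ℂ a ⊆ ball 0 R)
    (hf : Differentiable ℂ f) (L : 𝔸 →L[ℂ] E) (hK : Convex ℝ K) (hK₀ : K.Nonempty)
    {l : List ℂ} (hl : ∀ c ∈ l, c ∈ K)
    (hC : ∀ s ∈ Icc (0 : ℝ) 1, ∀ μ ∈ K,
      ‖L (circleCalculus a R fun z => iteratedDeriv l.length f ((1 - s) * μ + s * z))‖ ≤ C) :
    ‖L (circleCalculus a R (dividedDifference f l))‖ ≤ C / l.length.factorial := by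
  induction l generalizing f C with
  | nil =>
    obtain ⟨μ, hμ⟩ := hK₀
    simpa [dividedDifference] using hC 1 ⟨zero_le_one, le_rfl⟩ μ hμ
  | cons c l ih =>
    rw [List.forall_mem_cons] at hl
    have hstep := ih (differentiable_dslope hf c) hl.2 fun s hs μ hμ =>
      norm_circleCalculus_iteratedDeriv_dslope_le hR₀ hR hf L hK hl.1 l.length hC hs hμ
    rwa [div_div, ← Nat.cast_succ, ← Nat.cast_mul, ← Nat.factorial_succ] at hstep

end HermiteGenocchiBound

section EntireMatrixFunction

open Metric Polynomial
open scoped Matrix.Norms.Operator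

variable {n : ℕ} {f : ℂ → ℂ}

theorem enclosingRadius_pos (M : Matrix (Fin n) (Fin n) ℂ) : 0 < enclosingRadius M := by
  unfold enclosingRadius
  positivity

theorem spectrum_subset_ball_enclosingRadius (M : Matrix (Fin n) (Fin n) ℂ) :
    spectrum ℂ M ⊆ ball 0 (enclosingRadius M) := fun _ hz =>
  mem_ball_zero_iff.2 (norm_lt_enclosingRadius M hz)

theorem entireMatrixFunction_eq_circleCalculus (hf : Continuous f)
    (M : Matrix (Fin n) (Fin n) ℂ) :
    entireMatrixFunction f M = circleCalculus M (enclosingRadius M) f := by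
  ext i j
  have h := map_circleCalculus_eq_circleIntegral (enclosingRadius_pos M)
    (spectrum_subset_ball_enclosingRadius M) hf
    (LinearMap.toContinuousLinearMap (Matrix.entryLinearMap ℂ ℂ i j))
  simp only [resolvent, ← Matrix.nonsing_inv_eq_ringInverse, Algebra.algebraMap_eq_smul_one] at h
  exact h.symm

theorem entireMatrixFunction_exp (t : ℂ) (M : Matrix (Fin n) (Fin n) ℂ) :
    entireMatrixFunction (fun z => Complex.exp (t * z)) M = NormedSpace.exp (t • M) := by
  rw [entireMatrixFunction_eq_circleCalculus (by fun_prop)]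
  exact circleCalculus_exp (enclosingRadius_pos M) (spectrum_subset_ball_enclosingRadius M) t

theorem entireMatrixFunction_eval_mul (hf : Differentiable ℂ f) (p : ℂ[X])
    (M : Matrix (Fin n) (Fin n) ℂ) :
    entireMatrixFunction (fun z => p.eval z * f z) M = aeval M p * entireMatrixFunction f M := by
  have hcont : Continuous fun z => p.eval z * f z := p.continuous.mul hf.continuous
  rw [entireMatrixFunction_eq_circleCalculus hcont,
    entireMatrixFunction_eq_circleCalculus hf.continuous,
    circleCalculus_eval_mul (enclosingRadius_pos M) (spectrum_subset_ball_enclosingRadius M) hf]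

theorem entireMatrixFunction_eq_newton (hf : Differentiable ℂ f) (l : List ℂ)
    (M : Matrix (Fin n) (Fin n) ℂ) :
    entireMatrixFunction f M = aeval M (newtonPolynomial f l) +
      aeval M (l.map fun c => X - C c).prod * entireMatrixFunction (dividedDifference f l) M := by
  have hR₀ := enclosingRadius_pos M
  have hR := spectrum_subset_ball_enclosingRadius M
  have hdiff := differentiable_dividedDifference hf l
  calc entireMatrixFunction f M
      = circleCalculus M (enclosingRadius M) (fun z => (newtonPolynomial f l).eval z +
          (l.map fun c => X - C c).prod.eval z * dividedDifference f l z) := by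
        simp only [eval_newtonPolynomial_add]
        exact entireMatrixFunction_eq_circleCalculus hf.continuous M
    _ = _ := by
        rw [circleCalculus_add hR₀ hR (by fun_prop) (by have := hdiff.continuous; fun_prop),
          circleCalculus_eval hR₀ hR, circleCalculus_eval_mul hR₀ hR hdiff,
          entireMatrixFunction_eq_circleCalculus hdiff.continuous]

theorem commute_entireMatrixFunction (hf : Differentiable ℂ f) {B M : Matrix (Fin n) (Fin n) ℂ}
    (h : Commute B M) : Commute B (entireMatrixFunction f M) := by
  rw [entireMatrixFunction_eq_circleCalculus hf.continuous]
  exact commute_circleCalculus (enclosingRadius_pos M) (spectrum_subset_ball_enclosingRadius M) hf h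

theorem entireMatrixFunction_mulVec_aeval_mulVec (hf : Differentiable ℂ f) (p : ℂ[X])
    (M : Matrix (Fin n) (Fin n) ℂ) (x : Fin n → ℂ) :
    entireMatrixFunction f M *ᵥ (aeval M p *ᵥ x) =
      entireMatrixFunction (fun z => p.eval z * f z) M *ᵥ x := by
  have hcomm := commute_entireMatrixFunction hf ((commute_X p).symm.map (aeval M))
  rw [aeval_X] at hcomm
  rw [entireMatrixFunction_eval_mul hf, Matrix.mulVec_mulVec, hcomm.eq]

theorem entireMatrixFunction_smul_one_add_smul (hf : Differentiable ℂ f) (c s : ℂ)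
    (M : Matrix (Fin n) (Fin n) ℂ) :
    entireMatrixFunction f (c • (1 : Matrix (Fin n) (Fin n) ℂ) + s • M) =
      circleCalculus M (enclosingRadius M) fun z => f (c + s * z) := by
  rw [entireMatrixFunction_eq_circleCalculus hf.continuous]
  exact circleCalculus_comp_affine (enclosingRadius_pos M) (spectrum_subset_ball_enclosingRadius M)
    hf c s (enclosingRadius_pos _) (spectrum_subset_ball_enclosingRadius _)

end EntireMatrixFunction

section BoundTerm

open Metric Set
open scoped Matrix.Norms.Operator

variable {n N : ℕ} {A B : Matrix (Fin n) (Fin n) ℂ} {b : Fin n → ℂ} {g : ℂ → ℂ} {K : Set ℂ}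

/-- The map `M ↦ B M b` into Euclidean space. -/
noncomputable def mulVecEuclidean (B : Matrix (Fin n) (Fin n) ℂ) (b : Fin n → ℂ) :
    Matrix (Fin n) (Fin n) ℂ →ₗ[ℂ] EuclideanSpace ℂ (Fin n) :=
  (WithLp.linearEquiv 2 ℂ (Fin n → ℂ)).symm.toLinearMap ∘ₗ
    (Matrix.mulVecBilin ℂ ℂ).flip b ∘ₗ LinearMap.mulLeft ℂ B

theorem euclNorm_mul_mulVec (B M : Matrix (Fin n) (Fin n) ℂ) (b : Fin n → ℂ) :
    euclNorm ((B * M) *ᵥ b) = ‖mulVecEuclidean B b M‖ :=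
  rfl

/-- The norm of `B (g⁽ᴺ⁾((1 - s) μ 1 + s A) / N!) b`, the remainder term maximised in the estimate;
`arnoldiBoundTerm` is the case `B = Ω(A) v(A)⁻¹`, `g = v exp_t`. -/
noncomputable def remainderBoundTerm (A B : Matrix (Fin n) (Fin n) ℂ) (b : Fin n → ℂ) (g : ℂ → ℂ)
    (N : ℕ) (s : ℝ) (μ : ℂ) : ℝ :=
  euclNorm ((B * ((N.factorial : ℂ)⁻¹ • entireMatrixFunction (iteratedDeriv N g)
    (((1 - (s : ℂ)) * μ) • (1 : Matrix (Fin n) (Fin n) ℂ) + (s : ℂ) • A))) *ᵥ b)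

theorem remainderBoundTerm_eq (hg : Differentiable ℂ g) (s : ℝ) (μ : ℂ) :
    remainderBoundTerm A B b g N s μ =
      ‖mulVecEuclidean B b (circleCalculus A (enclosingRadius A) fun z =>
        iteratedDeriv N g ((1 - s) * μ + s * z))‖ / N.factorial := by
  rw [remainderBoundTerm, entireMatrixFunction_smul_one_add_smul
    (differentiable_iteratedDeriv_of_entire hg N), euclNorm_mul_mulVec, map_smul, norm_smul,
    norm_inv, Complex.norm_natCast, inv_mul_eq_div]

theorem continuous_remainderBoundTerm (A B : Matrix (Fin n) (Fin n) ℂ) (b : Fin n → ℂ) (N : ℕ)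
    (hg : Differentiable ℂ g) :
    Continuous fun x : ℝ × ℂ => remainderBoundTerm A B b g N x.1 x.2 := by
  simp only [remainderBoundTerm_eq hg]
  have hderiv := (differentiable_iteratedDeriv_of_entire hg N).continuous
  have hcalc := continuous_circleCalculus (enclosingRadius_pos A)
    (spectrum_subset_ball_enclosingRadius A)
    (F := fun (x : ℝ × ℂ) z => iteratedDeriv N g ((1 - x.1) * x.2 + x.1 * z)) (by fun_prop)
  exact (((mulVecEuclidean B b).continuous_of_finiteDimensional.comp hcalc).norm).div_const _

theorem exists_isGreatest_remainderBoundTerm (A B : Matrix (Fin n) (Fin n) ℂ) (b : Fin n → ℂ)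
    (N : ℕ) (hg : Differentiable ℂ g) (hK : IsCompact K) (hK₀ : K.Nonempty) :
    ∃ C, IsGreatest {c : ℝ | ∃ s ∈ Icc (0 : ℝ) 1, ∃ μ ∈ K, c = remainderBoundTerm A B b g N s μ}
      C := by
  obtain ⟨⟨s, μ⟩, ⟨hs, hμ⟩, hmax⟩ := (isCompact_Icc.prod hK).exists_isMaxOn
    ((nonempty_Icc.2 zero_le_one).prod hK₀)
    (continuous_remainderBoundTerm A B b N hg).continuousOn
  refine ⟨remainderBoundTerm A B b g N s μ, ⟨s, hs, μ, hμ, rfl⟩, ?_⟩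
  rintro _ ⟨s', hs', μ', hμ', rfl⟩
  exact isMaxOn_iff.1 hmax (s', μ') ⟨hs', hμ'⟩

theorem euclNorm_mul_dividedDifference_mulVec_le (hg : Differentiable ℂ g) (hK : Convex ℝ K)
    (hK₀ : K.Nonempty) {l : List ℂ} (hl : ∀ c ∈ l, c ∈ K) {C : ℝ}
    (hC : ∀ s ∈ Icc (0 : ℝ) 1, ∀ μ ∈ K, remainderBoundTerm A B b g l.length s μ ≤ C) :
    euclNorm ((B * entireMatrixFunction (dividedDifference g l) A) *ᵥ b) ≤ C := by
  have hfact : (0 : ℝ) < l.length.factorial := mod_cast l.length.factorial_pos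
  rw [euclNorm_mul_mulVec, entireMatrixFunction_eq_circleCalculus
    (differentiable_dividedDifference hg l).continuous, ← mul_div_cancel_right₀ C hfact.ne']
  refine norm_circleCalculus_dividedDifference_le (enclosingRadius_pos A)
    (spectrum_subset_ball_enclosingRadius A) hg
    (LinearMap.toContinuousLinearMap (mulVecEuclidean B b)) hK hK₀ hl fun s hs μ hμ => ?_
  have h := hC s hs μ hμ
  rwa [remainderBoundTerm_eq hg, div_le_iff₀ hfact] at h

end BoundTerm

section Krylov

open Polynomial

section Ring

variable {R ι κ : Type*} [CommRing R] [Fintype ι] [Fintype κ] [DecidableEq κ]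
  {A : Matrix ι ι R} {V : Matrix ι κ R} {W : Matrix κ ι R} {w : ι → R} {N : ℕ} {p : R[X]}

theorem mulVec_mulVec_of_mem_range (hWV : W * V = 1) {x : ι → R}
    (hx : x ∈ LinearMap.range V.mulVecLin) : V *ᵥ (W *ᵥ x) = x := by
  obtain ⟨y, rfl⟩ := hx
  rw [Matrix.mulVecLin_apply, Matrix.mulVec_mulVec y W, hWV, Matrix.one_mulVec]

variable [DecidableEq ι]

/-- The Krylov subspace spanned by `w, A w, …, A ^ (N - 1) w`. -/
def krylovSubspace (A : Matrix ι ι R) (w : ι → R) (N : ℕ) : Submodule R (ι → R) :=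
  Submodule.span R (Set.range fun j : Fin N => A ^ (j : ℕ) *ᵥ w)

theorem pow_mulVec_mem_krylovSubspace {j : ℕ} (hj : j < N) :
    A ^ j *ᵥ w ∈ krylovSubspace A w N :=
  Submodule.subset_span ⟨⟨j, hj⟩, rfl⟩

theorem aeval_mulVec_mem_krylovSubspace (hp : p.degree < N) :
    aeval A p *ᵥ w ∈ krylovSubspace A w N := by
  rw [aeval_eq_sum_range, Matrix.sum_mulVec]
  refine Submodule.sum_mem _ fun j _ => ?_
  rw [Matrix.smul_mulVec]
  rcases eq_or_ne (p.coeff j) 0 with hj | hj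
  · simp [hj]
  · have hjN : (j : WithBot ℕ) < N := (le_degree_of_ne_zero hj).trans_lt hp
    exact Submodule.smul_mem _ _ (pow_mulVec_mem_krylovSubspace (mod_cast hjN))

theorem mulVec_pow_mulVec_of_krylovSubspace_le (hWV : W * V = 1)
    (hK : krylovSubspace A w N ≤ LinearMap.range V.mulVecLin) {j : ℕ} (hj : j ≤ N) :
    W *ᵥ (A ^ j *ᵥ w) = (W * A * V) ^ j *ᵥ (W *ᵥ w) := by
  induction j with
  | zero => simp only [pow_zero, Matrix.one_mulVec]
  | succ j ih =>
    have hmem := hK (pow_mulVec_mem_krylovSubspace hj)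
    calc W *ᵥ (A ^ (j + 1) *ᵥ w)
        = W *ᵥ (A *ᵥ (V *ᵥ (W *ᵥ (A ^ j *ᵥ w)))) := by
          rw [mulVec_mulVec_of_mem_range hWV hmem, Matrix.mulVec_mulVec (M := A), pow_succ']
      _ = (W * A * V) ^ (j + 1) *ᵥ (W *ᵥ w) := by
          rw [ih (Nat.le_of_succ_le hj), pow_succ']
          simp only [Matrix.mulVec_mulVec, Matrix.mul_assoc]

theorem mulVec_aeval_mulVec_of_krylovSubspace_le (hWV : W * V = 1)
    (hK : krylovSubspace A w N ≤ LinearMap.range V.mulVecLin) (hp : p.natDegree ≤ N) :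
    W *ᵥ (aeval A p *ᵥ w) = aeval (W * A * V) p *ᵥ (W *ᵥ w) := by
  simp only [aeval_eq_sum_range, Matrix.sum_mulVec, Matrix.smul_mulVec, Matrix.mulVec_sum,
    Matrix.mulVec_smul]
  refine Finset.sum_congr rfl fun j hj => ?_
  rw [mulVec_pow_mulVec_of_krylovSubspace_le hWV hK
    ((Finset.mem_range_succ_iff.1 hj).trans hp)]

theorem mulVec_aeval_compression_mulVec (hWV : W * V = 1)
    (hK : krylovSubspace A w N ≤ LinearMap.range V.mulVecLin) (hp : p.degree < N) :
    V *ᵥ (aeval (W * A * V) p *ᵥ (W *ᵥ w)) = aeval A p *ᵥ w := by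
  rw [← mulVec_aeval_mulVec_of_krylovSubspace_le hWV hK
      (natDegree_le_of_degree_le hp.le),
    mulVec_mulVec_of_mem_range hWV (hK (aeval_mulVec_mem_krylovSubspace hp))]

theorem inv_pow_mulVec_aeval_mul_mulVec {c : R} (hc : c ∉ spectrum R A) (j : ℕ) (u : R[X]) :
    (c • (1 : Matrix ι ι R) - A)⁻¹ ^ j *ᵥ (aeval A ((C c - X) ^ j * u) *ᵥ w) = aeval A u *ᵥ w := by
  have hunit := spectrum.notMem_iff.1 hc
  rw [Algebra.algebraMap_eq_smul_one] at hunit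
  have hdet := (Matrix.isUnit_iff_isUnit_det _).1 (hunit.pow j)
  rw [map_mul, map_pow, map_sub, aeval_X, aeval_C, Algebra.algebraMap_eq_smul_one,
    Matrix.mulVec_mulVec, ← mul_assoc, Matrix.inv_pow', Matrix.nonsing_inv_mul _ hdet, one_mul]

end Ring

theorem finrank_range_mulVecLin_of_mul_eq_one {R ι κ : Type*} [CommRing R] [StrongRankCondition R]
    [Fintype ι] [Fintype κ] [DecidableEq κ] {V : Matrix ι κ R} {W : Matrix κ ι R}
    (hWV : W * V = 1) : Module.finrank R (LinearMap.range V.mulVecLin) = Fintype.card κ := by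
  have hinj : Function.Injective V.mulVecLin :=
    Function.LeftInverse.injective (g := W.mulVecLin) fun x => by
      rw [Matrix.mulVecLin_apply, Matrix.mulVecLin_apply, Matrix.mulVec_mulVec, hWV,
        Matrix.one_mulVec]
  rw [LinearMap.finrank_range_of_inj hinj, Module.finrank_fintype_fun_eq_card]

theorem finrank_krylovSubspace_le {R ι : Type*} [CommRing R] [StrongRankCondition R] [Fintype ι]
    [DecidableEq ι] (A : Matrix ι ι R) (w : ι → R) (N : ℕ) :
    Module.finrank R (krylovSubspace A w N) ≤ N :=
  (finrank_range_le_card _).trans_eq (Fintype.card_fin N)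

end Krylov

section RationalKrylov

open Polynomial

variable {n m : ℕ} {A : Matrix (Fin n) (Fin n) ℂ} {κ₀ : ℕ} {lam : Fin m → ℂ} {κ : Fin m → ℕ}

theorem monic_nodePolynomial (p : Fin m → ℂ) (w : Fin m → ℕ) : (nodePolynomial p w).Monic :=
  monic_prod_of_monic _ _ fun k _ => (monic_X_sub_C (p k)).pow (w k)

theorem natDegree_nodePolynomial (p : Fin m → ℂ) (w : Fin m → ℕ) :
    (nodePolynomial p w).natDegree = ∑ k, w k := by
  rw [nodePolynomial, natDegree_prod_of_monic _ _ fun k _ => (monic_X_sub_C (p k)).pow (w k)]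
  simp only [natDegree_pow, natDegree_X_sub_C, mul_one]

theorem C_sub_X_pow_dvd_nodePolynomial (p : Fin m → ℂ) {w : Fin m → ℕ} {k : Fin m} {j : ℕ}
    (hj : j ≤ w k) : (C (p k) - X) ^ j ∣ nodePolynomial p w :=
  calc (C (p k) - X) ^ j
      ∣ (X - C (p k)) ^ j := pow_dvd_pow_of_dvd (by rw [← neg_sub, neg_dvd]) j
    _ ∣ (X - C (p k)) ^ w k := pow_dvd_pow _ hj
    _ ∣ nodePolynomial p w :=
        Finset.dvd_prod_of_mem (fun k => (X - C (p k)) ^ w k) (Finset.mem_univ k)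

theorem isUnit_aeval_nodePolynomial (hlam : ∀ k, lam k ∉ spectrum ℂ A) (κ : Fin m → ℕ) :
    IsUnit (aeval A (nodePolynomial lam κ)) := by
  refine Finset.prod_induction _ (fun q => IsUnit (aeval A q)) (fun p q hp hq => ?_) ?_
    fun k _ => ?_
  · rw [map_mul]
    exact hp.mul hq
  · rw [map_one]
    exact isUnit_one
  · rw [map_pow, map_sub, aeval_X, aeval_C, ← neg_sub]
    exact (spectrum.notMem_iff.1 (hlam k)).neg.pow _

theorem nodePolynomial_eq_charpoly {M : Matrix (Fin n) (Fin n) ℂ} {p : Fin m → ℂ}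
    (hp : Function.Injective p) (hrange : Set.range p = spectrum ℂ M) {w : Fin m → ℕ}
    (hw : ∀ k, w k = M.charpoly.rootMultiplicity (p k)) : nodePolynomial p w = M.charpoly := by
  classical
  have hroots : M.charpoly.roots.toFinset = Finset.univ.image p := by
    ext z
    rw [Multiset.mem_toFinset, mem_roots M.charpoly_monic.ne_zero,
      ← Matrix.mem_spectrum_iff_isRoot_charpoly, ← hrange]
    simp
  rw [(IsAlgClosed.splits M.charpoly).eq_prod_roots_of_monic M.charpoly_monic,
    prod_multiset_root_eq_finset_root, hroots, Finset.prod_image hp.injOn, nodePolynomial]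
  simp only [hw]

theorem arnoldiVectors_mem_krylovSubspace (hlam : ∀ k, lam k ∉ spectrum ℂ A) (w : Fin n → ℂ)
    (i : Fin κ₀ ⊕ (Σ k : Fin m, Fin (κ k))) :
    arnoldiVectors A (aeval A (nodePolynomial lam κ) *ᵥ w) κ₀ lam κ i ∈
      krylovSubspace A w (κ₀ + ∑ k, κ k) := by
  have hne := (monic_nodePolynomial lam κ).ne_zero
  have hdeg := natDegree_nodePolynomial lam κ
  rcases i with j | ⟨k, j⟩
  · have hvec : arnoldiVectors A (aeval A (nodePolynomial lam κ) *ᵥ w) κ₀ lam κ (.inl j) =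
        aeval A (X ^ (j : ℕ) * nodePolynomial lam κ) *ᵥ w := by
      simp only [arnoldiVectors, Matrix.mulVec_mulVec, map_mul, map_pow, aeval_X]
    rw [hvec]
    refine aeval_mulVec_mem_krylovSubspace ?_
    rw [degree_mul, degree_X_pow, degree_eq_natDegree hne, hdeg]
    exact_mod_cast Nat.add_lt_add_right j.2 _
  · obtain ⟨u, hu⟩ := C_sub_X_pow_dvd_nodePolynomial lam (Nat.succ_le_of_lt j.2)
    rw [arnoldiVectors, hu, inv_pow_mulVec_aeval_mul_mulVec (hlam k)]
    refine aeval_mulVec_mem_krylovSubspace ?_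
    rw [hu] at hne
    have hu₀ := right_ne_zero_of_mul hne
    rw [hu, natDegree_mul (left_ne_zero_of_mul hne) hu₀, natDegree_pow, ← neg_sub, natDegree_neg,
      natDegree_X_sub_C] at hdeg
    rw [degree_eq_natDegree hu₀]
    exact_mod_cast (by omega : u.natDegree < κ₀ + ∑ k, κ k)

theorem span_arnoldiVectors (hlam : ∀ k, lam k ∉ spectrum ℂ A) {w : Fin n → ℂ}
    (hindep : LinearIndependent ℂ
      (arnoldiVectors A (aeval A (nodePolynomial lam κ) *ᵥ w) κ₀ lam κ)) :
    Submodule.span ℂ (Set.range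
        (arnoldiVectors A (aeval A (nodePolynomial lam κ) *ᵥ w) κ₀ lam κ)) =
      krylovSubspace A w (κ₀ + ∑ k, κ k) := by
  refine Submodule.eq_of_le_of_finrank_le (Submodule.span_le.2 ?_) ?_
  · rintro _ ⟨i, rfl⟩
    exact arnoldiVectors_mem_krylovSubspace hlam w i
  · rw [finrank_span_eq_card hindep]
    simpa using finrank_krylovSubspace_le A w (κ₀ + ∑ k, κ k)

theorem add_sum_eq_of_span_arnoldiVectors {N : ℕ} {b : Fin n → ℂ} {V : Matrix (Fin n) (Fin N) ℂ}
    {W : Matrix (Fin N) (Fin n) ℂ} (hWV : W * V = 1)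
    (hindep : LinearIndependent ℂ (arnoldiVectors A b κ₀ lam κ))
    (hspan : Submodule.span ℂ (Set.range (arnoldiVectors A b κ₀ lam κ)) =
      LinearMap.range V.mulVecLin) : κ₀ + ∑ k, κ k = N := by
  have h := finrank_range_mulVecLin_of_mul_eq_one hWV
  rw [← hspan, finrank_span_eq_card hindep] at h
  simpa using h

end RationalKrylov

section ErrorFormula

open Polynomial

variable {n N : ℕ} {A : Matrix (Fin n) (Fin n) ℂ} {V : Matrix (Fin n) (Fin N) ℂ}
  {W : Matrix (Fin N) (Fin n) ℂ} {w : Fin n → ℂ} {f : ℂ → ℂ}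

theorem length_charpoly_roots_toList (M : Matrix (Fin N) (Fin N) ℂ) :
    M.charpoly.roots.toList.length = N := by
  rw [Multiset.length_toList, IsAlgClosed.card_roots_eq_natDegree,
    Matrix.charpoly_natDegree_eq_dim, Fintype.card_fin]

theorem prod_map_charpoly_roots_toList (M : Matrix (Fin N) (Fin N) ℂ) :
    (M.charpoly.roots.toList.map fun c => X - C c).prod = M.charpoly := by
  conv_rhs => rw [(IsAlgClosed.splits M.charpoly).eq_prod_roots_of_monic M.charpoly_monic]
  rw [← Multiset.prod_coe, ← Multiset.map_coe, Multiset.coe_toList]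

theorem mem_spectrum_of_mem_charpoly_roots_toList {M : Matrix (Fin N) (Fin N) ℂ} {c : ℂ}
    (hc : c ∈ M.charpoly.roots.toList) : c ∈ spectrum ℂ M :=
  Matrix.mem_spectrum_iff_isRoot_charpoly.2 (isRoot_of_mem_roots (Multiset.mem_toList.1 hc))

/-- The Newton polynomial of `f` at the eigenvalues of the compression has degree less than `N`, so
the projection reproduces it; its remainder is killed by Cayley–Hamilton in the compression. -/
theorem entireMatrixFunction_mulVec_sub_compression (hf : Differentiable ℂ f) (hWV : W * V = 1)
    (hK : krylovSubspace A w N ≤ LinearMap.range V.mulVecLin) :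
    entireMatrixFunction f A *ᵥ w - V *ᵥ (entireMatrixFunction f (W * A * V) *ᵥ (W *ᵥ w)) =
      (aeval A (W * A * V).charpoly *
        entireMatrixFunction (dividedDifference f (W * A * V).charpoly.roots.toList) A) *ᵥ w := by
  set l := (W * A * V).charpoly.roots.toList with hl
  have hdeg : (newtonPolynomial f l).degree < N := by
    simpa only [hl, length_charpoly_roots_toList] using degree_newtonPolynomial_lt f l
  rw [entireMatrixFunction_eq_newton hf l A, entireMatrixFunction_eq_newton hf l (W * A * V), hl,
    prod_map_charpoly_roots_toList, Matrix.aeval_self_charpoly, zero_mul, add_zero, ← hl,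
    mulVec_aeval_compression_mulVec hWV hK hdeg, Matrix.add_mulVec, add_sub_cancel_left]

theorem nonsing_inv_aeval_mul_entireMatrixFunction_mulVec (hf : Differentiable ℂ f) {v : ℂ[X]}
    (hv : IsUnit (aeval A v).det) (x : Fin n → ℂ) :
    ((aeval A v)⁻¹ * entireMatrixFunction f A) *ᵥ (aeval A v *ᵥ x) =
      entireMatrixFunction f A *ᵥ x := by
  rw [← Matrix.mulVec_mulVec, entireMatrixFunction_mulVec_aeval_mulVec hf,
    entireMatrixFunction_eval_mul hf, Matrix.mulVec_mulVec,
    Matrix.nonsing_inv_mul_cancel_left _ _ hv]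

theorem entireMatrixFunction_mulVec_aeval_sub_compression (hf : Differentiable ℂ f)
    (hWV : W * V = 1) (hK : krylovSubspace A w N ≤ LinearMap.range V.mulVecLin) {v : ℂ[X]}
    (hdeg : v.natDegree ≤ N) (hv : IsUnit (aeval A v).det) :
    entireMatrixFunction f A *ᵥ (aeval A v *ᵥ w) -
        V *ᵥ (entireMatrixFunction f (W * A * V) *ᵥ (W *ᵥ (aeval A v *ᵥ w))) =
      (aeval A (W * A * V).charpoly * (aeval A v)⁻¹ * entireMatrixFunction
        (dividedDifference (fun z => v.eval z * f z) (W * A * V).charpoly.roots.toList) A) *ᵥ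
        (aeval A v *ᵥ w) := by
  have hg : Differentiable ℂ fun z => v.eval z * f z := v.differentiable.mul hf
  rw [mulVec_aeval_mulVec_of_krylovSubspace_le hWV hK hdeg,
    entireMatrixFunction_mulVec_aeval_mulVec hf, entireMatrixFunction_mulVec_aeval_mulVec hf,
    entireMatrixFunction_mulVec_sub_compression hg hWV hK, mul_assoc,
    ← Matrix.mulVec_mulVec (M := aeval A _), ← Matrix.mulVec_mulVec (M := aeval A _),
    nonsing_inv_aeval_mul_entireMatrixFunction_mulVec (differentiable_dividedDifference hg _) hv]

end ErrorFormula

theorem theoremt_general {n nhat m mhat : ℕ} (hnhat : 0 < nhat)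
    (A : Matrix (Fin n) (Fin n) ℂ) (b : Fin n → ℂ)
    (κ₀ : ℕ) (lam : Fin m → ℂ) (κ : Fin m → ℕ)
    (hlam : ∀ k, lam k ∉ spectrum ℂ A)
    (V : Matrix (Fin n) (Fin nhat) ℂ) (W : Matrix (Fin nhat) (Fin n) ℂ) (hWV : W * V = 1)
    (hindep : LinearIndependent ℂ (arnoldiVectors A b κ₀ lam κ))
    (hspan : Submodule.span ℂ (Set.range (arnoldiVectors A b κ₀ lam κ)) =
      LinearMap.range V.mulVecLin)
    (muhat : Fin mhat → ℂ) (hmu_inj : Function.Injective muhat)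
    (hmu : Set.range muhat = spectrum ℂ (W * A * V))
    (what : Fin mhat → ℕ)
    (hwhat : ∀ k, what k = (W * A * V).charpoly.rootMultiplicity (muhat k))
    {f : ℂ → ℂ} (hf : Differentiable ℂ f) :
    ∃ C : ℝ,
      IsGreatest
        {c : ℝ | ∃ s ∈ Set.Icc (0 : ℝ) 1, ∃ μ ∈ convexHull ℝ (Set.range muhat),
          c = remainderBoundTerm A
            (Polynomial.aeval A (nodePolynomial muhat what) *
              (Polynomial.aeval A (nodePolynomial lam κ))⁻¹) b
            (fun z => (nodePolynomial lam κ).eval z * f z) nhat s μ} C ∧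
      euclNorm (entireMatrixFunction f A *ᵥ b -
        V *ᵥ (entireMatrixFunction f (W * A * V) *ᵥ (W *ᵥ b))) ≤ C := by
  rw [nodePolynomial_eq_charpoly hmu_inj hmu hwhat]
  set v := nodePolynomial lam κ
  set l := (W * A * V).charpoly.roots.toList
  have hlen : l.length = nhat := length_charpoly_roots_toList _
  have hl : ∀ c ∈ l, c ∈ convexHull ℝ (Set.range muhat) := fun c hc =>
    subset_convexHull ℝ _ (hmu ▸ mem_spectrum_of_mem_charpoly_roots_toList hc)
  have hhull : (convexHull ℝ (Set.range muhat)).Nonempty :=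
    (List.exists_mem_of_length_pos (hlen ▸ hnhat)).imp hl
  have hv : IsUnit (Polynomial.aeval A v).det :=
    (Matrix.isUnit_iff_isUnit_det _).1 (isUnit_aeval_nodePolynomial hlam κ)
  obtain ⟨w, rfl⟩ := Matrix.mulVec_surjective_iff_isUnit.2 ((Matrix.isUnit_iff_isUnit_det _).2 hv) b
  have hdim : κ₀ + ∑ k, κ k = nhat := add_sum_eq_of_span_arnoldiVectors hWV hindep hspan
  have hK : krylovSubspace A w nhat ≤ LinearMap.range V.mulVecLin := by
    rw [← hspan, span_arnoldiVectors hlam hindep, hdim]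
  have hdeg : v.natDegree ≤ nhat := by
    rw [natDegree_nodePolynomial, ← hdim]
    exact Nat.le_add_left _ _
  have hg : Differentiable ℂ fun z => v.eval z * f z := v.differentiable.mul hf
  obtain ⟨C, hC⟩ := exists_isGreatest_remainderBoundTerm A _ (Polynomial.aeval A v *ᵥ w) nhat hg
    ((Set.finite_range muhat).isCompact_convexHull ℝ) hhull
  refine ⟨C, hC, ?_⟩
  rw [entireMatrixFunction_mulVec_aeval_sub_compression hf hWV hK hdeg hv]
  refine euclNorm_mul_dividedDifference_mulVec_le hg (convex_convexHull ℝ _) hhull hl ?_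
  rw [hlen]
  exact fun s hs μ hμ => hC.2 ⟨s, hs, μ, hμ, rfl⟩

theorem theoremt {n nhat m mhat : ℕ} (hnhat : 0 < nhat)
    (A : Matrix (Fin n) (Fin n) ℂ) (b : Fin n → ℂ)
    (κ₀ : ℕ) (lam : Fin m → ℂ) (κ : Fin m → ℕ)
    (hlam : ∀ k, lam k ∉ spectrum ℂ A)
    (V : Matrix (Fin n) (Fin nhat) ℂ) (hV : Vᴴ * V = 1)
    (hindep : LinearIndependent ℂ (arnoldiVectors A b κ₀ lam κ))
    (hspan : Submodule.span ℂ (Set.range (arnoldiVectors A b κ₀ lam κ)) =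
      LinearMap.range V.mulVecLin)
    (Ahat : Matrix (Fin nhat) (Fin nhat) ℂ) (hAhat : Ahat = Vᴴ * A * V)
    (bhat : Fin nhat → ℂ) (hbhat : bhat = Vᴴ *ᵥ b)
    (muhat : Fin mhat → ℂ) (hmu_inj : Function.Injective muhat)
    (hmu : Set.range muhat = spectrum ℂ Ahat)
    (what : Fin mhat → ℕ) (hwhat : ∀ k, what k = Ahat.charpoly.rootMultiplicity (muhat k))
    (t : ℝ) :
    ∃ C : ℝ,
      IsGreatest
        {c : ℝ | ∃ s ∈ Set.Icc (0 : ℝ) 1, ∃ μ ∈ convexHull ℝ (Set.range muhat),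
          c = arnoldiBoundTerm A b (nodePolynomial muhat what) (nodePolynomial lam κ) nhat t s μ} C ∧
      euclNorm (NormedSpace.exp ((t : ℂ) • A) *ᵥ b -
        V *ᵥ (NormedSpace.exp ((t : ℂ) • Ahat) *ᵥ bhat)) ≤ C := by
  subst hAhat hbhat
  have h := theoremt_general hnhat A b κ₀ lam κ hlam V Vᴴ hV hindep hspan muhat hmu_inj hmu what
    hwhat (f := fun z => Complex.exp (t * z)) (by fun_prop)
  rwa [entireMatrixFunction_exp, entireMatrixFunction_exp] at h
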